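/- Let $X$ be a compactum, i.e. a compact metrizable space. A $\sigma$-ideal on $X$ is a collection $I$ of Borel subsets of $X$ containing $\emptyset$ and closed under taking Borel subsets and countable unions; it is homogeneous if for each Borel set $E\subseteq X$ with $E\notin I$ there exists a Borel map $f:X\to E$ such that $f^{-1}(A)\in I$ whenever $A\in I$. For a Borel measure $\mu$ on $X$ (with values in $[0,\infty]$), let $J_0(\mu)$ (respectively $J_f(\mu)$) be the $\sigma$-ideal of Borel sets in $X$ that can be covered by countably many compact sets of $\mu$-measure zero (respectively, of finite $\mu$-measure). The measure $\mu$ is semifinite if each Borel set of positive $\mu$-measure contains a Borel set of finite positive $\mu$-measure, and nonatomic if $\mu(\{x\})=0$ for every $x\in X$ (for semifinite Borel measures on compacta this is equivalent to the absence of measure-theoretic atoms). Let $\mu$ be a semifinite nonatomic Borel measure on a compactum $X$ with $\mu(X)>0$. (i) The $\sigma$-ideal $J_0(\mu)$ is not homogeneous. (ii) Suppose, moreover, that $\mu$ is not $\sigma$-finite (in particular, $X\notin J_f(\mu)$), that there exists a Borel set $Y\notin J_f(\mu)$ with $\mu(Y)<\infty$, and that the map $K\mapsto\mu(K)$ from the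 hyperspace $K(X)$ of compact subsets of $X$, equipped with the Vietoris topology, to $[0,\infty]$ is Borel. Then the $\sigma$-ideal $J_f(\mu)$ is not homogeneous. -/

import Mathlib

open Set MeasureTheory TopologicalSpace
open scoped ENNReal

/-- A `σ`-ideal on `X`: a collection of Borel sets closed under taking Borel subsets and
countable unions. -/
structure BorelSigmaIdeal (X : Type*) [MeasurableSpace X] where
  /-- The sets belonging to the `σ`-ideal. -/
  carrier : Set (Set X)
  measurableSet_of_mem : ∀ A ∈ carrier, MeasurableSet A
  empty_mem : ∅ ∈ carrier
  subset_mem : ∀ A ∈ carrier, ∀ B : Set X, MeasurableSet B → B ⊆ A → B ∈ carrier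
  iUnion_mem : ∀ A : ℕ → Set X, (∀ n, A n ∈ carrier) → (⋃ n, A n) ∈ carrier

namespace BorelSigmaIdeal

instance {X : Type*} [MeasurableSpace X] : Membership (Set X) (BorelSigmaIdeal X) where
  mem I A := A ∈ I.carrier

/-- A `σ`-ideal `I` is homogeneous if for each Borel set `E` not in `I` there is a Borel map
`f : X → E` such that `f ⁻¹(A) ∈ I` whenever `A ∈ I`. -/
def IsHomogeneous {X : Type*} [MeasurableSpace X] (I : BorelSigmaIdeal X) : Prop :=
  ∀ E : Set X, MeasurableSet E → E ∉ I →
    ∃ f : X → E, Measurable f ∧ ∀ A : Set X, A ∈ I → {x : X | (f x : X) ∈ A} ∈ I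

/-- The `σ`-ideal of Borel sets that can be covered by countably many compact sets with the
property `P`. (The empty set is compact, so countable covers can be indexed by `ℕ`.) -/
def coveredByCompacts {X : Type*} [TopologicalSpace X] [MeasurableSpace X]
    (P : Set X → Prop) (hP : P ∅) : BorelSigmaIdeal X where
  carrier := {A | MeasurableSet A ∧
    ∃ K : ℕ → Set X, (∀ n, IsCompact (K n) ∧ P (K n)) ∧ A ⊆ ⋃ n, K n}
  measurableSet_of_mem := fun _ hA => hA.1
  empty_mem := ⟨MeasurableSet.empty, fun _ => ∅, fun _ => ⟨isCompact_empty, hP⟩, empty_subset _⟩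
  subset_mem := by
    rintro A ⟨-, K, hK, hAK⟩ B hB hBA
    exact ⟨hB, K, hK, hBA.trans hAK⟩
  iUnion_mem := by
    intro A hA
    refine ⟨MeasurableSet.iUnion fun n => (hA n).1, ?_⟩
    choose K hK hAK using fun n => (hA n).2
    refine ⟨fun m => K m.unpair.1 m.unpair.2, fun m => hK _ _, ?_⟩
    intro x hx
    obtain ⟨n, hn⟩ := mem_iUnion.1 hx
    obtain ⟨k, hk⟩ := mem_iUnion.1 (hAK n hn)
    exact mem_iUnion.2 ⟨Nat.pair n k, by simpa using hk⟩

/-- `J₀(μ)`: the Borel sets that can be covered by countably many compact sets of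
`μ`-measure zero. -/
def J0 {X : Type*} [TopologicalSpace X] [MeasurableSpace X] (μ : Measure X) :
    BorelSigmaIdeal X :=
  coveredByCompacts (fun K => μ K = 0) (measure_empty (μ := μ))

/-- `J_f(μ)`: the Borel sets that can be covered by countably many compact sets of finite
`μ`-measure. -/
def Jf {X : Type*} [TopologicalSpace X] [MeasurableSpace X] (μ : Measure X) :
    BorelSigmaIdeal X :=
  coveredByCompacts (fun K => μ K < ∞) (by simp)

end BorelSigmaIdeal

/-- A measure is semifinite if each measurable set of positive measure contains a measurable set
of finite positive measure. -/
def IsSemifinite {X : Type*} [MeasurableSpace X] (μ : Measure X) : Prop :=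
  ∀ B : Set X, MeasurableSet B → 0 < μ B →
    ∃ C : Set X, MeasurableSet C ∧ C ⊆ B ∧ 0 < μ C ∧ μ C < ∞

/-- The map `K ↦ μ(K)` on the hyperspace `K(X)` of compact subsets of `X`, with the Vietoris
topology, is Borel. -/
def IsBorelOnHyperspace {X : Type*} [TopologicalSpace X] [MeasurableSpace X]
    (μ : Measure X) : Prop :=
  Measurable[borel (Compacts X)] (fun K : Compacts X => μ (K : Set X))

/-! Both parts rest on `not_isHomogeneous_coveredByCompacts`. If `f : X → E` witnesses homogeneity,
`f ⁻¹(C)` lies in the ideal, hence is `ν`-null, for each compact `C ⊆ E`; inner regularity of the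
image of `ν` then forces `ν = 0`.

For `J0 μ`, take `ν = μ|K` with `K` compact of finite positive measure, and `E` a null dense `Gδ` in
the support of `ν`; by Baire, null compacta do not cover it.

For `Jf μ`, take `E = Y`. The measure `ν` averages the normalized restrictions of `μ` to a Cantor
family of pairwise almost disjoint compacta, with respect to a diffuse measure on the indices. A set
of finite measure meets only countably many members in positive measure, so `ν` kills it. The family
comes from a Mycielski argument on the hyperspace, under a finer Polish topology; failure of
`σ`-finiteness keeps the available compacta from being exhausted. -/

theorem IsSemifinite.exists_isCompact_subset {X : Type*} [TopologicalSpace X] [CompactSpace X]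
    [MetrizableSpace X] [MeasurableSpace X] [BorelSpace X] {μ : Measure X} (hμ : IsSemifinite μ)
    {B : Set X} (hB : MeasurableSet B) (hpos : 0 < μ B) :
    ∃ K ⊆ B, IsCompact K ∧ 0 < μ K ∧ μ K < ∞ := by
  obtain ⟨C, hC, hCB, hC0, hCt⟩ := hμ B hB hpos
  have : IsFiniteMeasure (μ.restrict C) := ⟨by simpa using hCt⟩
  obtain ⟨K, hKC, hK, hK0⟩ := hC.exists_lt_isCompact_of_ne_top (μ := μ.restrict C) (r := 0)
    (by simpa using hCt.ne) (by simpa using hC0)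
  rw [Measure.restrict_apply hK.measurableSet, inter_eq_left.2 hKC] at hK0
  exact ⟨K, hKC.trans hCB, hK, hK0, (measure_mono hKC).trans_lt hCt⟩

/-- The preimage of a Borel set under a Borel map carries no mass as soon as the preimages of all
its compact subsets carry none. -/
theorem measure_eq_zero_of_preimage_isCompact {Ω X : Type*} [MeasurableSpace Ω]
    [TopologicalSpace X] [CompactSpace X]
    [MetrizableSpace X] [MeasurableSpace X] [BorelSpace X] (ν : Measure Ω) [IsFiniteMeasure ν]
    {E : Set X} (hE : MeasurableSet E) {f : Ω → E} (hf : Measurable f)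
    (h : ∀ C ⊆ E, IsCompact C → ν {x | (f x : X) ∈ C} = 0) : ν = 0 := by
  by_contra hν
  have hg : Measurable fun x => (f x : X) := measurable_subtype_coe.comp hf
  obtain ⟨C, hCE, hC, hC0⟩ := hE.exists_lt_isCompact_of_ne_top
    (μ := ν.map fun x => (f x : X)) (r := 0) (measure_ne_top _ _) (by
      rw [Measure.map_apply hg hE]
      have : (fun x => (f x : X)) ⁻¹' E = univ := by ext x; simp
      rw [this]
      exact Measure.measure_univ_pos.2 hν)
  rw [Measure.map_apply hg hC.measurableSet] at hC0
  exact hC0.ne' (h C hCE hC)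

namespace BorelSigmaIdeal

theorem mem_coveredByCompacts_of_isCompact {X : Type*} [TopologicalSpace X] [T2Space X]
    [MeasurableSpace X] [BorelSpace X] {P : Set X → Prop} {hP : P ∅} {C : Set X}
    (hC : IsCompact C) (h : P C) : C ∈ coveredByCompacts P hP :=
  ⟨hC.measurableSet, fun _ => C, fun _ => ⟨hC, h⟩, fun _ hx => mem_iUnion.2 ⟨0, hx⟩⟩

theorem measure_eq_zero_of_mem_coveredByCompacts {X : Type*} [TopologicalSpace X]
    [MeasurableSpace X] {P : Set X → Prop} {hP : P ∅} {ν : Measure X}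
    (hν : ∀ C, IsCompact C → P C → ν C = 0) {A : Set X}
    (hA : A ∈ coveredByCompacts P hP) : ν A = 0 := by
  obtain ⟨-, K, hK, hAK⟩ := hA
  exact measure_mono_null hAK (measure_iUnion_null fun n => hν _ (hK n).1 (hK n).2)

/-- A `σ`-ideal generated by compact sets is not homogeneous if there is a nonzero finite measure
vanishing on it, and a Borel set outside it all of whose compact subsets belong to it. -/
theorem not_isHomogeneous_coveredByCompacts {X : Type*} [TopologicalSpace X] [CompactSpace X]
    [MetrizableSpace X] [MeasurableSpace X] [BorelSpace X] {P : Set X → Prop} {hP : P ∅}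
    (ν : Measure X) [IsFiniteMeasure ν] (hν0 : ν ≠ 0) (hν : ∀ C, IsCompact C → P C → ν C = 0)
    {E : Set X} (hE : MeasurableSet E) (hEI : E ∉ coveredByCompacts P hP)
    (hEP : ∀ C ⊆ E, IsCompact C → P C) : ¬ (coveredByCompacts P hP).IsHomogeneous := by
  intro hhom
  obtain ⟨f, hf, hfI⟩ := hhom E hE hEI
  refine hν0 (measure_eq_zero_of_preimage_isCompact ν hE hf fun C hCE hC => ?_)
  exact measure_eq_zero_of_mem_coveredByCompacts hν
    (hfI C (mem_coveredByCompacts_of_isCompact hC (hEP C hCE hC)))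

end BorelSigmaIdeal

/-! ### Null sets that null compacta cannot cover -/

/-- In a compact metrizable space, a nonzero finite diffuse measure admits a Borel null set that is
not covered by countably many compact null sets. -/
theorem exists_null_not_subset_iUnion_isCompact {X : Type*} [TopologicalSpace X] [CompactSpace X]
    [MetrizableSpace X] [MeasurableSpace X] [BorelSpace X] (ν : Measure X) [IsFiniteMeasure ν]
    [NullSingletonClass ν] (hν : ν ≠ 0) :
    ∃ E ⊆ ν.support, MeasurableSet E ∧ ν E = 0 ∧
      ∀ K : ℕ → Set X, (∀ n, IsCompact (K n) ∧ ν (K n) = 0) → ¬ E ⊆ ⋃ n, K n := by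
  let := metrizableSpaceMetric X
  set S := ν.support with hS
  have hSc : IsClosed S := Measure.isClosed_support
  obtain ⟨D, hDc, hDd⟩ := TopologicalSpace.exists_countable_dense S
  have hD0 : ν ((↑) '' D : Set X) = 0 := (hDc.image _).measure_zero ν
  have hO (n : ℕ) : ∃ U ⊇ ((↑) '' D : Set X), IsOpen U ∧ ν U < ((n : ℝ≥0∞) + 1)⁻¹ :=
    Set.exists_isOpen_lt_of_lt _ _ (by rw [hD0]; simp)
  choose U hDU hU hUlt using hO
  refine ⟨S ∩ ⋂ n, U n, inter_subset_left,
    hSc.measurableSet.inter (MeasurableSet.iInter fun n => (hU n).measurableSet), ?_, ?_⟩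
  · refine le_antisymm (ENNReal.le_of_forall_pos_le_add fun ε hε _ => ?_) zero_le
    obtain ⟨n, hn⟩ := ENNReal.exists_inv_nat_lt (a := ε) (by simpa using hε.ne')
    calc ν (S ∩ ⋂ n, U n) ≤ ν (U n) :=
          measure_mono (inter_subset_right.trans (iInter_subset _ n))
      _ ≤ ((n : ℝ≥0∞) + 1)⁻¹ := (hUlt n).le
      _ ≤ (n : ℝ≥0∞)⁻¹ := ENNReal.inv_le_inv.2 le_self_add
      _ ≤ 0 + ε := by simpa using hn.le
  · intro K hK hcov
    have : CompactSpace S := isCompact_iff_compactSpace.1 hSc.isCompact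
    have : Nonempty S := (Measure.nonempty_support hν).to_subtype
    have hd1 (n : ℕ) : Dense ((↑) ⁻¹' U n : Set S) :=
      hDd.mono fun x hx => hDU n (mem_image_of_mem _ hx)
    -- Nonempty relatively open subsets of the support have positive measure, so a null compact set
    -- has empty interior in it.
    have hd2 (n : ℕ) : Dense ((↑) ⁻¹' (K n)ᶜ : Set S) := by
      intro x
      rw [mem_closure_iff_nhds]
      intro t ht
      obtain ⟨u, hu, hut⟩ := mem_nhds_subtype _ _ _ |>.1 ht
      have hpos : 0 < ν (u \ K n) := by
        rw [measure_sdiff_null (hK n).2]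
        exact (Measure.mem_support_iff_forall _).1 x.2 u hu
      obtain ⟨y, hy, hyS⟩ := Measure.nonempty_inter_support_of_pos hpos
      exact ⟨⟨y, hyS⟩, hut hy.1, hy.2⟩
    have ho1 (n : ℕ) : IsOpen ((↑) ⁻¹' U n : Set S) := (hU n).preimage continuous_subtype_val
    have ho2 (n : ℕ) : IsOpen ((↑) ⁻¹' (K n)ᶜ : Set S) :=
      (hK n).1.isClosed.isOpen_compl.preimage continuous_subtype_val
    obtain ⟨x, hx⟩ := (dense_iInter_of_isOpen_nat (fun n => (ho1 n).inter (ho2 n))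
      fun n => (hd1 n).inter_of_isOpen_left (hd2 n) (ho1 n)).nonempty
    simp only [mem_iInter, mem_inter_iff, mem_preimage, mem_compl_iff] at hx
    obtain ⟨n, hn⟩ := mem_iUnion.1 (hcov ⟨x.2, mem_iInter.2 fun n => (hx n).1⟩)
    exact (hx n).2 hn

theorem BorelSigmaIdeal.not_isHomogeneous_J0 {X : Type*} [TopologicalSpace X] [CompactSpace X]
    [MetrizableSpace X] [MeasurableSpace X] [BorelSpace X] {μ : Measure X} [NullSingletonClass μ]
    (hsemi : IsSemifinite μ) (hpos : 0 < μ univ) : ¬ (J0 μ).IsHomogeneous := by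
  obtain ⟨K, -, hK, hK0, hKt⟩ := hsemi.exists_isCompact_subset MeasurableSet.univ hpos
  have : IsFiniteMeasure (μ.restrict K) := ⟨by simpa using hKt⟩
  have hν : μ.restrict K ≠ 0 := by simpa using hK0.ne'
  obtain ⟨E, hES, hE, hE0, hEcov⟩ := exists_null_not_subset_iUnion_isCompact (μ.restrict K) hν
  have hEK : E ⊆ K := hES.trans
    (Measure.support_subset_of_isClosed hK.isClosed (self_mem_ae_restrict hK.measurableSet))
  have hμE : μ E = 0 := by rwa [Measure.restrict_apply hE, inter_eq_left.2 hEK] at hE0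
  refine not_isHomogeneous_coveredByCompacts (μ.restrict K) hν
    (fun C hC h => Measure.absolutelyContinuous_of_le Measure.restrict_le_self h) hE ?_
    fun C hCE _ => measure_mono_null hCE hμE
  rintro ⟨-, L, hL, hcov⟩
  exact hEcov L (fun n => ⟨(hL n).1,
    Measure.absolutelyContinuous_of_le Measure.restrict_le_self (hL n).2⟩) hcov

/-! ### Independent Cantor sets by Baire category -/

-- The non-cluster points are covered by countably many basic open sets, each with complement in
-- `ℱ`.
open Filter Topology in
theorem eventually_clusterPt_of_secondCountable {T : Type*} [TopologicalSpace T]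
    [SecondCountableTopology T] (ℱ : Filter T) [CountableInterFilter ℱ] :
    ∀ᶠ x in ℱ, ClusterPt x ℱ := by
  have h : ∀ᶠ x in ℱ, ∀ b ∈ countableBasis T, (∀ᶠ y in ℱ, y ∉ b) → x ∉ b := by
    rw [eventually_countable_ball (countable_countableBasis T)]
    intro b _
    by_cases hb : ∀ᶠ y in ℱ, y ∉ b
    · filter_upwards [hb] with x hx _ using hx
    · exact Eventually.of_forall fun x h => absurd h hb
  filter_upwards [h] with x hx
  rw [(isBasis_countableBasis T).nhds_hasBasis.clusterPt_iff_frequently]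
  intro b hb hev
  exact hx b hb.1 hev hb.2

/-- A symmetric relation such that every nonempty open set contains a point related to finitely
many prescribed ones admits related selections from finitely many nonempty open sets. -/
theorem exists_forall_mem_pairwise {T ι : Type*} [Finite ι]
    (r : T → T → Prop) (hr : ∀ K L, r K L → r L K) (U : ι → Set T)
    (h : ∀ (i : ι) (F : Set T), F.Finite → ∃ L ∈ U i, ∀ K ∈ F, r K L) :
    ∃ L : ι → T, (∀ i, L i ∈ U i) ∧ ∀ i j, i ≠ j → r (L i) (L j) := by
  classical
  have := Fintype.ofFinite ι
  suffices H : ∀ s : Finset ι, ∃ L : ι → T, (∀ i ∈ s, L i ∈ U i) ∧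
      ∀ i ∈ s, ∀ j ∈ s, i ≠ j → r (L i) (L j) by
    obtain ⟨L, h1, h2⟩ := H Finset.univ
    exact ⟨L, fun i => h1 i (Finset.mem_univ _), fun i j =>
      h2 i (Finset.mem_univ _) j (Finset.mem_univ _)⟩
  intro s
  induction s using Finset.induction_on with
  | empty =>
    exact ⟨fun i => (h i ∅ finite_empty).choose, by simp, by simp⟩
  | insert a s ha ih =>
    obtain ⟨L, h1, h2⟩ := ih
    obtain ⟨M, hM, hMr⟩ := h a (L '' (s : Set ι)) (s.finite_toSet.image _)
    have hMs : ∀ i ∈ s, r (L i) M := fun i hi => hMr _ (mem_image_of_mem _ hi)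
    have hne : ∀ i ∈ s, i ≠ a := fun i hi e => ha (e ▸ hi)
    refine ⟨Function.update L a M, ?_, ?_⟩
    · intro i hi
      rcases Finset.mem_insert.1 hi with rfl | hi
      · simpa using hM
      · simpa [hne i hi] using h1 i hi
    · intro i hi j hj hij
      rw [Finset.mem_insert] at hi hj
      rcases hi with rfl | hi <;> rcases hj with rfl | hj
      · exact absurd rfl hij
      · simpa [hne j hj] using hr _ _ (hMs j hj)
      · simpa [hne i hi] using hMs i hi
      · simpa [hne i hi, hne j hj] using h2 i hi j hj hij

open Topology in
/-- Continuous maps from the Cantor space to a metric space are, up to `ε`, locally constant at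
some finite level, which may be taken arbitrarily large. -/
theorem exists_dist_lt_of_forall_lt_eq {T : Type*} [MetricSpace T] {g : (ℕ → Bool) → T}
    (hg : Continuous g) {ε : ℝ} (hε : 0 < ε) (k : ℕ) :
    ∃ m > k, ∀ x y : ℕ → Bool, (∀ i < m, x i = y i) → dist (g x) (g y) < ε := by
  -- Pairs with distant images form a compact set off the diagonal, so finitely many coordinates
  -- separate them all.
  set A : Set ((ℕ → Bool) × (ℕ → Bool)) := {p | ε ≤ dist (g p.1) (g p.2)} with hA
  have hAc : IsCompact A := (isClosed_le continuous_const (by fun_prop)).isCompact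
  obtain ⟨t, ht⟩ := hAc.elim_finite_subcover (fun i : ℕ => {p | p.1 i ≠ p.2 i})
    (fun i => isOpen_ne_fun (by fun_prop) (by fun_prop)) (by
      intro p hp
      by_contra hcon
      simp only [mem_iUnion, mem_ofPred_eq, not_exists, not_not] at hcon
      have : p.1 = p.2 := funext hcon
      simp [hA, this] at hp
      linarith)
  refine ⟨max (t.sup id) k + 1, by omega, fun x y hxy => ?_⟩
  by_contra hcon
  obtain ⟨i, hi, hi'⟩ := mem_iUnion₂.1 (ht (show (x, y) ∈ A from not_lt.1 hcon))
  have : i ≤ t.sup id := Finset.le_sup (f := id) hi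
  exact hi' (hxy i (by omega))

open Filter Topology in
/-- A Mycielski-type theorem: generic continuous images of the Cantor space in a Polish space are
independent for relations given by countably many open sets, as soon as one can choose in each
nonempty open set a point related to finitely many prescribed ones. -/
theorem exists_continuous_cantor_pairwise {T : Type*} [TopologicalSpace T] [PolishSpace T]
    [Nonempty T] (O : ℕ → Set (T × T)) (hO : ∀ n, IsOpen (O n))
    (h : ∀ (U : Set T) (F : Set T), IsOpen U → U.Nonempty → F.Finite →
      ∃ L ∈ U, ∀ K ∈ F, ∀ n, (K, L) ∈ O n ∧ (L, K) ∈ O n) :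
    ∃ g : (ℕ → Bool) → T, Continuous g ∧ ∀ x y, x ≠ y → ∀ n, (g x, g y) ∈ O n := by
  let := upgradeIsCompletelyMetrizable T
  -- The off-diagonal is cut into compact pieces, so that each requirement is open in the
  -- compact-open topology.
  let D : ℕ → Set ((ℕ → Bool) × (ℕ → Bool)) := fun i => {p | p.1 i ≠ p.2 i}
  have hD (i : ℕ) : IsCompact (D i) := by
    have : IsClosed (D i) := by
      have : D i = (fun p : (ℕ → Bool) × (ℕ → Bool) => (p.1 i, p.2 i)) ⁻¹' {q | q.1 ≠ q.2} := rfl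
      rw [this]
      exact (isClosed_discrete _).preimage (by fun_prop)
    exact this.isCompact
  let S : ℕ × ℕ → Set C(ℕ → Bool, T) := fun q => {g | MapsTo (Prod.map g g) (D q.1) (O q.2)}
  have hS (q : ℕ × ℕ) : IsOpen (S q) := by
    have hc : Continuous fun g : C(ℕ → Bool, T) => g.prodMap g := by
      refine ContinuousMap.continuous_of_continuous_uncurry _ ?_
      simp only [Function.uncurry_def, ContinuousMap.prodMap_apply, Prod.map_apply']
      fun_prop
    exact (ContinuousMap.isOpen_setOfPred_mapsTo (hD q.1) (hO q.2)).preimage hc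
  have hSd (q : ℕ × ℕ) : Dense (S q) := by
    intro g
    rw [Metric.mem_closure_iff]
    intro ε hε
    -- Approximate `g` by a map depending on the first `m` coordinates; `m > q.1` ensures that
    -- points differing at `q.1` get distinct prefixes.
    obtain ⟨m, hm, hgm⟩ := exists_dist_lt_of_forall_lt_eq g.continuous (half_pos hε) q.1
    let e : (Fin m → Bool) → ℕ → Bool := fun s i => if hi : i < m then s ⟨i, hi⟩ else false
    obtain ⟨L, hL, hLr⟩ := exists_forall_mem_pairwise
      (fun K L => ∀ n, (K, L) ∈ O n ∧ (L, K) ∈ O n) (fun K L hKL n => (hKL n).symm)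
      (fun s => Metric.ball (g (e s)) (ε / 2)) fun s F hF =>
        h _ F Metric.isOpen_ball ⟨_, Metric.mem_ball_self (half_pos hε)⟩ hF
    let ρ : (ℕ → Bool) → Fin m → Bool := fun x i => x i
    have hρ : Continuous ρ := by fun_prop
    refine ⟨⟨fun x => L (ρ x), continuous_of_discreteTopology.comp hρ⟩, ?_, ?_⟩
    · rintro ⟨x, y⟩ hxy
      refine (hLr (ρ x) (ρ y) (fun hne => hxy ?_) q.2).1
      exact congrFun hne ⟨q.1, hm⟩
    · rw [ContinuousMap.dist_lt_iff hε]
      intro x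
      have h1 : dist (g x) (g (e (ρ x))) < ε / 2 := hgm _ _ fun i hi => by simp [e, ρ, hi]
      have h2 : dist (L (ρ x)) (g (e (ρ x))) < ε / 2 := hL (ρ x)
      calc dist (g x) (L (ρ x)) ≤ dist (g x) (g (e (ρ x))) + dist (L (ρ x)) (g (e (ρ x))) :=
            dist_triangle_right _ _ _
        _ < ε := by linarith
  have : Nonempty C(ℕ → Bool, T) := ‹Nonempty T›.map (ContinuousMap.const _)
  obtain ⟨g, hg⟩ := (dense_iInter_of_isOpen hS hSd).nonempty
  refine ⟨g, g.continuous, fun x y hxy n => ?_⟩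
  obtain ⟨i, hi⟩ := Function.ne_iff.1 hxy
  exact mem_iInter.1 hg (i, n) (show (x, y) ∈ D i from hi)

-- On the closed set of cluster points, every nonempty relatively open set is `ℱ`-frequent, so it
-- contains a point related to any finitely many given ones.
open Filter Topology in
theorem exists_continuous_cantor_pairwise_of_eventually {T : Type*} [TopologicalSpace T]
    [PolishSpace T] (ℱ : Filter T) [ℱ.NeBot] [CountableInterFilter ℱ] (O : ℕ → Set (T × T))
    (hO : ∀ n, IsOpen (O n)) (h : ∀ K n, ∀ᶠ L in ℱ, (K, L) ∈ O n ∧ (L, K) ∈ O n) :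
    ∃ g : (ℕ → Bool) → T, Continuous g ∧ ∀ x y, x ≠ y → ∀ n, (g x, g y) ∈ O n := by
  let P : Set T := {x | ClusterPt x ℱ}
  have hPℱ : ∀ᶠ x in ℱ, x ∈ P := eventually_clusterPt_of_secondCountable ℱ
  have hP : IsClosed P := isClosed_setOfPred_clusterPt
  have := hP.polishSpace
  have : Nonempty P := nonempty_subtype.2 hPℱ.exists
  obtain ⟨g, hg, hgO⟩ := exists_continuous_cantor_pairwise
    (fun n => Prod.map ((↑) : P → T) ((↑) : P → T) ⁻¹' O n)
    (fun n => (hO n).preimage (by fun_prop)) fun U F hU hUne hF => by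
      obtain ⟨V, hV, rfl⟩ := isOpen_induced_iff.1 hU
      obtain ⟨x, hx⟩ := hUne
      have hfr : ∃ᶠ y in ℱ, y ∈ V := clusterPt_iff_frequently.1 x.2 V (hV.mem_nhds hx)
      have hev : ∀ᶠ L in ℱ, ∀ K ∈ F, ∀ n, ((K : T), L) ∈ O n ∧ (L, (K : T)) ∈ O n := by
        rw [eventually_countable_ball hF.countable]
        exact fun K _ => eventually_countable_forall.2 fun n => h K n
      obtain ⟨L, hLV, hLP, hL⟩ := (hfr.and_eventually (hPℱ.and hev)).exists
      exact ⟨⟨L, hLP⟩, hLV, hL⟩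
  exact ⟨fun x => g x, continuous_subtype_val.comp hg, hgO⟩

/-! ### Borel maps on the hyperspace -/

/-- Intersecting with a fixed closed set is a Borel operation on the hyperspace of compact sets. -/
theorem TopologicalSpace.Compacts.measurable_inter_isClosed {X : Type*} [TopologicalSpace X]
    [CompactSpace X] [MetrizableSpace X] {F : Set X} (hF : IsClosed F) :
    Measurable[borel (Compacts X), borel (Compacts X)]
      (fun K : Compacts X => (⟨K ∩ F, K.isCompact.inter_right hF⟩ : Compacts X)) := by
  let := metrizableSpaceMetric X
  let : MeasurableSpace (Compacts X) := borel _
  have : BorelSpace (Compacts X) := ⟨rfl⟩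
  have hb : borel (Compacts X) = .generateFrom
      (preimage (fun K : Compacts X => (K : Set X)) ''
        (powerset '' {U | IsOpen U} ∪ (fun V => {s | (s ∩ V).Nonempty}) '' {V | IsOpen V})) :=
    borel_eq_generateFrom_of_subbasis induced_generateFrom_eq
  suffices h : Measurable[borel (Compacts X), .generateFrom
      (preimage (fun K : Compacts X => (K : Set X)) ''
        (powerset '' {U | IsOpen U} ∪ (fun V => {s | (s ∩ V).Nonempty}) '' {V | IsOpen V}))]
      (fun K : Compacts X => (⟨K ∩ F, K.isCompact.inter_right hF⟩ : Compacts X)) by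
    rwa [← hb] at h
  refine measurable_generateFrom ?_
  rintro _ ⟨_, ⟨U, hU, rfl⟩ | ⟨U, hU, rfl⟩, rfl⟩
  · have : (fun K : Compacts X => (⟨K ∩ F, K.isCompact.inter_right hF⟩ : Compacts X)) ⁻¹'
        ((fun K : Compacts X => (K : Set X)) ⁻¹' U.powerset) =
        {K : Compacts X | (K : Set X) ⊆ U ∪ Fᶜ} := by
      ext K
      simp only [mem_preimage, mem_powerset_iff, Compacts.coe_mk, mem_ofPred_eq]
      rw [union_comm, ← inter_subset]
    rw [this]
    exact (Compacts.isOpen_subsets_of_isOpen (hU.union hF.isOpen_compl)).measurableSet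
  -- `F ∩ U` need not be open; writing `U` as an `Fσ` reduces meeting it to countably many closed
  -- conditions.
  · obtain ⟨G, hG, -, hGU, -⟩ := IsOpen.exists_iUnion_isClosed (show IsOpen U from hU)
    have : (fun K : Compacts X => (⟨K ∩ F, K.isCompact.inter_right hF⟩ : Compacts X)) ⁻¹'
        ((fun K : Compacts X => (K : Set X)) ⁻¹' {s | (s ∩ U).Nonempty}) =
        ⋃ n, {K : Compacts X | ((K : Set X) ∩ (F ∩ G n)).Nonempty} := by
      ext K
      simp only [mem_preimage, Compacts.coe_mk, mem_ofPred_eq, mem_iUnion, ← nonempty_iUnion,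
        ← inter_iUnion, hGU, inter_assoc]
    rw [this]
    exact MeasurableSet.iUnion fun n =>
      (Compacts.isClosed_inter_nonempty_of_isClosed (hF.inter (hG n))).measurableSet

theorem IsBorelOnHyperspace.measurable_measure_inter {X : Type*} [TopologicalSpace X]
    [CompactSpace X] [MetrizableSpace X] [MeasurableSpace X] {μ : Measure X}
    (hμ : IsBorelOnHyperspace μ) {F : Set X} (hF : IsClosed F) :
    Measurable[borel (Compacts X)] fun K : Compacts X => μ (K ∩ F) :=
  @Measurable.comp _ _ _ (borel _) (borel _) _ (fun K : Compacts X => μ K) _ hμ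
    (Compacts.measurable_inter_isClosed hF)

/-- Any compact set has arbitrarily small open neighbourhoods with respect to a given finite
measure, whose closures are still small, and that are finite unions of basic open sets. -/
theorem exists_finset_countableBasis_measure_closure_lt {X : Type*} [TopologicalSpace X]
    [CompactSpace X] [MetrizableSpace X] [MeasurableSpace X] [BorelSpace X]
    [SecondCountableTopology X] (ν : Measure X) [IsFiniteMeasure ν] {L : Set X} (hL : IsCompact L)
    {r : ℝ≥0∞} (hr : ν L < r) :
    ∃ J : Finset (countableBasis X), L ⊆ ⋃ b ∈ J, (b : Set X) ∧
      ν (closure (⋃ b ∈ J, (b : Set X))) < r := by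
  let := metrizableSpaceMetric X
  obtain ⟨W, hLW, hW, hWr⟩ := L.exists_isOpen_lt_of_lt r hr
  obtain ⟨V, hV, hLV, hVW⟩ := normal_exists_closure_subset hL.isClosed hW hLW
  obtain ⟨J, hJ⟩ := hL.elim_finite_subcover
    (fun b : {b : countableBasis X // (b : Set X) ⊆ V} => (b.1 : Set X))
    (fun b => isOpen_of_mem_countableBasis b.1.2) (by
      intro x hx
      obtain ⟨b, hb, hxb, hbV⟩ := (isBasis_countableBasis X).exists_subset_of_mem_open (hLV hx) hV
      exact mem_iUnion.2 ⟨⟨⟨b, hb⟩, hbV⟩, hxb⟩)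
  classical
  refine ⟨J.image Subtype.val, by rwa [Finset.set_biUnion_finset_image], (measure_mono ?_).trans_lt hWr⟩
  refine (closure_mono ?_).trans hVW
  rw [Finset.set_biUnion_finset_image]
  exact iUnion₂_subset fun b _ => b.2

/-! ### Almost disjoint compacta and their average -/

open Filter Topology in
/-- A semifinite measure that is not `σ`-finite and is Borel on the hyperspace admits a Cantor set
of pairwise almost disjoint compact sets of finite positive measure. -/
theorem IsSemifinite.exists_continuous_cantor_aedisjoint {X : Type*} [TopologicalSpace X]
    [CompactSpace X] [MetrizableSpace X] [MeasurableSpace X] [BorelSpace X] {μ : Measure X}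
    (hsemi : IsSemifinite μ) (hσ : ¬ SigmaFinite μ) (hborel : IsBorelOnHyperspace μ) :
    ∃ g : (ℕ → Bool) → Compacts X, Continuous g ∧ (∀ x, 0 < μ (g x) ∧ μ (g x) < ∞) ∧
      Pairwise fun x y => μ (g x ∩ g y) = 0 := by
  let := metrizableSpaceMetric X
  let τ₀ : TopologicalSpace (Compacts X) := inferInstance
  let : MeasurableSpace (Compacts X) := borel _
  have : BorelSpace (Compacts X) := ⟨rfl⟩
  let V : Finset (countableBasis X) → Set X := fun J => ⋃ b ∈ J, (b : Set X)
  have : Countable (countableBasis X) := (countable_countableBasis X).to_subtype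
  let f : Compacts X → ℝ≥0∞ × (Finset (countableBasis X) → ℝ≥0∞) :=
    fun K => (μ K, fun J => μ (K ∩ closure (V J)))
  have hf : Measurable f := Measurable.prodMk hborel
    (measurable_pi_iff.2 fun J => hborel.measurable_measure_inter isClosed_closure)
  have hτ₀ (U : Set X) (hU : IsOpen U) : IsOpen[τ₀] {K : Compacts X | (K : Set X) ⊆ U} :=
    Compacts.isOpen_subsets_of_isOpen hU
  -- A finer Polish topology makes these countably many Borel functions continuous.
  obtain ⟨τ, hτ, hfc, hpol⟩ := hf.exists_continuous
  let T : Set (Compacts X) := {K | 0 < μ K ∧ μ K < ∞}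
  have hT : IsOpen[τ] T := by
    let := τ
    exact (isOpen_Ioo (a := (0 : ℝ≥0∞)) (b := ∞)).preimage (continuous_fst.comp hfc)
  have hTpol : @PolishSpace T (@instTopologicalSpaceSubtype _ _ τ) := by
    let := τ
    exact hT.polishSpace
  let τT : TopologicalSpace T := @instTopologicalSpaceSubtype _ _ τ
  have hTf (J) : Continuous fun K : T => μ (K ∩ closure (V J)) := by
    let := τ
    exact (continuous_apply J).comp (continuous_snd.comp (hfc.comp continuous_subtype_val))
  have hTv : Continuous[τT, τ₀] ((↑) : T → Compacts X) :=
    @Continuous.comp _ _ _ τT τ τ₀ _ _ (continuous_id_of_le hτ) (@continuous_subtype_val _ τ _)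
  let O : ℕ → Set (T × T) := fun n => {p | μ (p.1 ∩ p.2) < ((n : ℝ≥0∞) + 1)⁻¹}
  have hO (n : ℕ) : IsOpen (O n) := by
    rw [isOpen_iff_mem_nhds]
    rintro ⟨K, L⟩ hKL
    have : IsFiniteMeasure (μ.restrict (K : Set X)) := ⟨by simpa using K.2.2⟩
    -- Fattening `L` to `V J` decouples the variables: `L' ⊆ V J` is open in `L'`, and smallness of
    -- `μ (K' ∩ closure (V J))` is open in `K'`.
    obtain ⟨J, hLJ, hJ⟩ := exists_finset_countableBasis_measure_closure_lt
      (μ.restrict (K : Set X)) L.1.isCompact (r := ((n : ℝ≥0∞) + 1)⁻¹) (by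
        rw [Measure.restrict_apply L.1.isCompact.measurableSet, inter_comm]
        exact hKL)
    rw [Measure.restrict_apply isClosed_closure.measurableSet, inter_comm] at hJ
    have h1 : {K' : T | μ (K' ∩ closure (V J)) < ((n : ℝ≥0∞) + 1)⁻¹} ∈ 𝓝 K :=
      (isOpen_Iio.preimage (hTf J)).mem_nhds hJ
    have hVo : IsOpen (V J) := isOpen_biUnion fun b _ => isOpen_of_mem_countableBasis b.2
    have h2 : {L' : T | (L' : Set X) ⊆ V J} ∈ 𝓝 L :=
      (@IsOpen.preimage _ _ τT τ₀ _ hTv _ (hτ₀ _ hVo)).mem_nhds hLJ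
    filter_upwards [prod_mem_nhds h1 h2]
    rintro ⟨K', L'⟩ ⟨hK', hL'⟩
    exact (measure_mono (inter_subset_inter_right _ (hL'.trans subset_closure))).trans_lt hK'
  -- The negligible families are those whose members all meet, in positive measure, some term of a
  -- single sequence of sets of finite measure.
  let ℱ : Filter T := Filter.ofCountableUnion
    {N | ∃ B : ℕ → Set X, (∀ n, μ (B n) < ∞) ∧ ∀ K ∈ N, ∃ n, 0 < μ (K ∩ B n)}
    (by
      intro S hS hSN
      choose! B hB hBN using hSN
      rcases S.eq_empty_or_nonempty with rfl | hne
      · exact ⟨fun _ => ∅, by simp, by simp⟩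
      obtain ⟨e, he⟩ := hS.exists_eq_range hne
      refine ⟨fun n => B (e n.unpair.1) n.unpair.2, fun n => hB _ (he ▸ mem_range_self _) _, ?_⟩
      rintro K ⟨N, hN, hKN⟩
      obtain ⟨m, rfl⟩ : N ∈ range e := he ▸ hN
      obtain ⟨n, hn⟩ := hBN _ hN K hKN
      exact ⟨Nat.pair m n, by simpa using hn⟩)
    (fun N ⟨B, hB, hBN⟩ M hMN => ⟨B, hB, fun K hK => hBN K (hMN hK)⟩)
  have hℱ : ℱ.NeBot := by
    rw [neBot_iff]
    intro hbot
    have hmem : (∅ : Set T) ∈ ℱ := by rw [hbot]; exact mem_bot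
    obtain ⟨B, hB, hBT⟩ := Filter.mem_ofCountableUnion.1 hmem
    -- Otherwise the measurable hulls and a null remainder would make `μ` `σ`-finite. Semifiniteness
    -- then yields a compact set missing every `B n`.
    have hpos : 0 < μ (⋃ n, toMeasurable μ (B n))ᶜ := by
      by_contra hcon
      have h0 : μ (⋃ n, toMeasurable μ (B n))ᶜ = 0 := by simpa using hcon
      refine hσ ⟨⟨⟨fun n => Nat.casesOn n (⋃ n, toMeasurable μ (B n))ᶜ
        fun n => toMeasurable μ (B n), fun _ => trivial, ?_, ?_⟩⟩⟩
      · rintro (_ | n)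
        · exact h0 ▸ ENNReal.zero_lt_top
        · simpa using hB n
      · refine eq_univ_of_forall fun x => ?_
        by_cases hx : x ∈ ⋃ n, toMeasurable μ (B n)
        · obtain ⟨n, hn⟩ := mem_iUnion.1 hx
          exact mem_iUnion.2 ⟨n + 1, hn⟩
        · exact mem_iUnion.2 ⟨0, hx⟩
    obtain ⟨K, hKB, hK, hK0, hKt⟩ := hsemi.exists_isCompact_subset
      (MeasurableSet.iUnion fun n => measurableSet_toMeasurable μ (B n)).compl hpos
    obtain ⟨n, hn⟩ := hBT ⟨⟨K, hK⟩, hK0, hKt⟩ (by simp)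
    have hKn : K ∩ B n = ∅ := by
      rw [← disjoint_iff_inter_eq_empty]
      exact (disjoint_compl_left_iff_subset.2 ((subset_toMeasurable μ (B n)).trans
        (subset_iUnion (fun n => toMeasurable μ (B n)) n))).mono_left hKB
    simp [hKn] at hn
  obtain ⟨g, hg, hgO⟩ := exists_continuous_cantor_pairwise_of_eventually ℱ O hO fun K n => by
    refine Filter.mem_ofCountableUnion.2 ⟨fun _ => (K : Set X), fun _ => K.2.2, fun L hL => ?_⟩
    refine ⟨0, pos_iff_ne_zero.2 fun h0 => hL ?_⟩
    simp [O, h0, inter_comm (K : Set X)]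
  refine ⟨fun x => g x, @Continuous.comp _ _ _ _ τT τ₀ _ _ hTv hg, fun x => (g x).2, fun x y hxy => ?_⟩
  refine le_antisymm (ENNReal.le_of_forall_pos_le_add fun ε hε _ => ?_) zero_le
  obtain ⟨n, hn⟩ := ENNReal.exists_inv_nat_lt (a := ε) (by simpa using hε.ne')
  calc μ (g x ∩ g y) ≤ ((n : ℝ≥0∞) + 1)⁻¹ := (hgO x y hxy n).le
    _ ≤ (n : ℝ≥0∞)⁻¹ := ENNReal.inv_le_inv.2 le_self_add
    _ ≤ 0 + ε := by simpa using hn.le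

theorem exists_isProbabilityMeasure_nullSingletonClass_cantor :
    ∃ p : Measure (ℕ → Bool), IsProbabilityMeasure p ∧ NullSingletonClass p := by
  let e : ℝ ≃ᵐ (ℕ → Bool) := PolishSpace.measurableEquivOfNotCountable
    (not_countable_iff.2 inferInstance) (by
      intro h
      obtain ⟨f, hf⟩ := exists_surjective_nat (ℕ → Bool)
      obtain ⟨n, hn⟩ := hf fun n => !f n n
      simpa using congrFun hn n)
  refine ⟨(volume.restrict (Icc (0 : ℝ) 1)).map e, ⟨?_⟩, ⟨fun x => ?_⟩⟩
  · simp [e.map_apply]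
  · rw [e.map_apply, ← e.image_symm, image_singleton]
    exact measure_singleton _

/-- A semifinite measure that is not `σ`-finite and is Borel on the hyperspace admits a Borel
probability measure vanishing on all sets of finite measure. -/
theorem IsSemifinite.exists_isProbabilityMeasure_eq_zero {X : Type*} [TopologicalSpace X]
    [CompactSpace X] [MetrizableSpace X] [MeasurableSpace X] [BorelSpace X] {μ : Measure X}
    (hsemi : IsSemifinite μ) (hσ : ¬ SigmaFinite μ) (hborel : IsBorelOnHyperspace μ) :
    ∃ ν : Measure X, IsProbabilityMeasure ν ∧ ∀ A, MeasurableSet A → μ A < ∞ → ν A = 0 := by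
  obtain ⟨g, hg, hgT, hgd⟩ := hsemi.exists_continuous_cantor_aedisjoint hσ hborel
  obtain ⟨p, hp, hp0⟩ := exists_isProbabilityMeasure_nullSingletonClass_cantor
  let : MeasurableSpace (Compacts X) := borel _
  have : BorelSpace (Compacts X) := ⟨rfl⟩
  have hgm : ∀ F : Set X, IsClosed F → Measurable fun x => μ (g x ∩ F) := fun F hF =>
    (hborel.measurable_measure_inter hF).comp hg.measurable
  let κ : (ℕ → Bool) → Measure X := fun x => ProbabilityTheory.cond μ (g x)
  have hκ (x) : IsProbabilityMeasure (κ x) :=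
    ProbabilityTheory.cond_isProbabilityMeasure_of_finite (hgT x).1.ne' (hgT x).2.ne
  have hκm : Measurable κ := by
    refine Measurable.measure_of_isPiSystem_of_isProbabilityMeasure
      ((BorelSpace.measurable_eq (α := X)).trans borel_eq_generateFrom_isClosed)
      isPiSystem_isClosed fun F hF => ?_
    simp only [κ, ProbabilityTheory.cond_apply (g _).isCompact.measurableSet]
    exact (hborel.comp hg.measurable).inv.mul (hgm F hF)
  have hν (A : Set X) (hA : MeasurableSet A) : p.bind κ A = ∫⁻ x, κ x A ∂p :=
    Measure.bind_apply hA hκm.aemeasurable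
  refine ⟨p.bind κ, ⟨by simp [hν]⟩, fun A hA hAt => ?_⟩
  rw [hν A hA]
  refine (lintegral_congr_ae ?_).trans lintegral_zero
  -- The traces on `A` are almost disjoint inside a set of finite measure.
  have hc : {x | 0 < μ ((g x : Set X) ∩ A)}.Countable :=
    Measure.countable_meas_pos_of_disjoint_of_meas_iUnion_ne_top₀ μ
      (fun x => ((g x).isCompact.measurableSet.inter hA).nullMeasurableSet)
      (fun x y hxy => measure_mono_null
        (inter_subset_inter inter_subset_left inter_subset_left) (hgd hxy))
      ((measure_mono (iUnion_subset fun x => inter_subset_right)).trans_lt hAt).ne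
  filter_upwards [hc.ae_notMem p] with x hx
  have : μ ((g x : Set X) ∩ A) = 0 := by simpa using hx
  simp [κ, ProbabilityTheory.cond_apply (g x).isCompact.measurableSet, this]

/-! ### The ideal `Jf μ` and the conclusion -/

namespace BorelSigmaIdeal

theorem univ_notMem_Jf {X : Type*} [TopologicalSpace X] [MeasurableSpace X] {μ : Measure X}
    (hσ : ¬ SigmaFinite μ) : univ ∉ Jf μ := by
  rintro ⟨-, K, hK, hcov⟩
  exact hσ ⟨⟨⟨K, fun _ => trivial, fun n => (hK n).2, univ_subset_iff.1 hcov⟩⟩⟩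

theorem not_isHomogeneous_Jf {X : Type*} [TopologicalSpace X] [CompactSpace X]
    [MetrizableSpace X] [MeasurableSpace X] [BorelSpace X] {μ : Measure X}
    (hsemi : IsSemifinite μ) (hσ : ¬ SigmaFinite μ) (hborel : IsBorelOnHyperspace μ) {Y : Set X}
    (hY : MeasurableSet Y) (hYJ : Y ∉ Jf μ) (hYt : μ Y < ∞) : ¬ (Jf μ).IsHomogeneous := by
  obtain ⟨ν, hν, hν0⟩ := hsemi.exists_isProbabilityMeasure_eq_zero hσ hborel
  exact not_isHomogeneous_coveredByCompacts ν (IsProbabilityMeasure.ne_zero ν)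
    (fun C hC h => hν0 C hC.measurableSet h) hY hYJ
    fun C hCY _ => (measure_mono hCY).trans_lt hYt

end BorelSigmaIdeal

theorem mainTheorem4 {X : Type*} [TopologicalSpace X] [CompactSpace X] [MetrizableSpace X]
    [MeasurableSpace X] [BorelSpace X] (μ : Measure X) [NullSingletonClass μ]
    (hsemi : IsSemifinite μ) (hpos : 0 < μ Set.univ) :
    ¬ (BorelSigmaIdeal.J0 μ).IsHomogeneous ∧
    (¬ SigmaFinite μ →
      (∃ Y : Set X, MeasurableSet Y ∧ Y ∉ BorelSigmaIdeal.Jf μ ∧ μ Y < ∞) →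
      IsBorelOnHyperspace μ →
      Set.univ ∉ BorelSigmaIdeal.Jf μ ∧ ¬ (BorelSigmaIdeal.Jf μ).IsHomogeneous) := by
  refine ⟨BorelSigmaIdeal.not_isHomogeneous_J0 hsemi hpos, ?_⟩
  rintro hσ ⟨Y, hY, hYJ, hYt⟩ hborel
  exact ⟨BorelSigmaIdeal.univ_notMem_Jf hσ,
    BorelSigmaIdeal.not_isHomogeneous_Jf hsemi hσ hborel hY hYJ hYt⟩
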